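/- **Separation lemma.** Let $0<m\le n$ be integers, $U\subset\mathbb R^n$ open, $Y$ a finite dimensional real normed vector space, $D\subset Y$ closed, and $K\subset Y\setminus D$ compact. Let $V$ be an $m$-dimensional varifold in $U$, i.e. a Radon measure on $U\times G(n,m)$, where $G(n,m)$ is the Grassmannian of $m$-planes in $\mathbb R^n$. Write $P_S$ for the orthogonal projection onto $S\in G(n,m)$, $\|V\|(A)=V(A\times G(n,m))$ for the weight, $V\llcorner A$ for the restriction of $V$ to $A\times G(n,m)$, $\delta V(\theta)=\int \operatorname{trace}(P_S\circ D\theta(x))\,dV(x,S)$ for $\theta\in C_c^\infty(U,\mathbb R^n)$ for the first variation, and $\|\delta V\|$ for its total variation measure. If $\|\delta V\|$ is a Radon measure, $\delta V$ also denotes the continuous extension to $L^1(\|\delta V\|,\mathbb R^n)$, and the boundary of a $(\|V\|+\|\delta V\|)$-measurable set $E\subset U$ is the distribution $V\,\partial E(\theta)=\delta V(1_E\theta)-\delta(V\llcorner E)(\theta)$. A *partition* of $V$ is a set $\Pi$ of $m$-dimensional varifolds in $U$ such that: (a) each $W\in\Pi$ is of the form $W=V\llcorner E$ with $E$ a $(\|V\|+\|\delta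 V\|)$-measurable set, $\|V\|(E)>0$ and $V\,\partial E=0$; (b) $\int\beta\,dV=\sum_{W\in\Pi}\int\beta\,dW$ for all $\beta\in C_c(U\times G(n,m),\mathbb R)$; (c) $\int\varphi\,d\|\delta V\|=\sum_{W\in\Pi}\int\varphi\,d\|\delta W\|$ for all $\varphi\in C_c(U,\mathbb R)$. A *partitioned component* of $V$ is an element of a partition of $V$. If $\|\delta V\|$ is a Radon measure, a $(\|V\|+\|\delta V\|)$-measurable function $f$ on $U$ with values in $Y$ (defined almost everywhere) is *generalised $V$-weakly differentiable* if there is a $\|V\|$-measurable $F$ with values in $\operatorname{Hom}(\mathbb R^n,Y)$ such that $\int_{C\cap\{|f|\le s\}}\|F\|\,d\|V\|<\infty$ for all compact $C\subset U$ and $0\le s<\infty$, and $$\delta V((\gamma\circ f)\theta)=\int\gamma(f(x))\operatorname{trace}(P_S\circ D\theta(x))\,dV(x,S)+\int D\gamma(f(x))\big(F(x)(\theta(x))\big)\,d\|V\|(x)$$ for all $\theta\in C_c^\infty(U,\mathbb R^n)$ and all $\gamma\in C^\infty(Y,\mathbb R)$ such that $D\gamma$ has compact support. Assume that $\|\delta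 V\|$ is a Radon measure, that $\|\delta V\|$ is absolutely continuous with respect to $\|V\|$ (its singular part vanishes), and that $f$ is a generalised $V$-weakly differentiable function with values in $Y$ such that $\|V\|(U\setminus f^{-1}(D\cup K))=0$ and $\|V\|(f^{-1}(K))>0$. Then $W=V\llcorner f^{-1}(K)$ is a partitioned component of $V$, $V\,\partial(f^{-1}(K))=0$, $\|W\|(U\setminus f^{-1}(K))=0$, $\|\delta W\|$ is a Radon measure, and $f$ is generalised $W$-weakly differentiable. -/

import Mathlib

open MeasureTheory Set Filter Topology TopologicalSpace
open scoped ENNReal ContDiff Distributions CompactlySupported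

noncomputable section

namespace VarifoldTheory

/-- `ℝⁿ` with its Euclidean norm. -/
abbrev E (n : ℕ) : Type := EuclideanSpace ℝ (Fin n)

/-! ### The Grassmannian -/

/-- The Grassmannian `G(n, m)` of `m`-dimensional linear subspaces of `ℝⁿ`. -/
def Grass (n m : ℕ) : Type := {S : Submodule ℝ (E n) // Module.finrank ℝ S = m}

namespace Grass

variable {n m : ℕ}

/-- The orthogonal projection of `ℝⁿ` onto the plane `S`, as an endomorphism of `ℝⁿ`. -/
def proj (S : Grass n m) : E n →L[ℝ] E n := S.1.starProjection

theorem proj_injective : Function.Injective (proj : Grass n m → E n →L[ℝ] E n) := by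
  intro S T h
  exact Subtype.ext (Submodule.starProjection_inj.1 h)

/-- `G(n, m)` carries the topology of the corresponding orthogonal projections. -/
instance : TopologicalSpace (Grass n m) := TopologicalSpace.induced proj inferInstance

theorem isEmbedding_proj : IsEmbedding (proj : Grass n m → E n →L[ℝ] E n) :=
  ⟨⟨rfl⟩, proj_injective⟩

theorem continuous_proj : Continuous (proj : Grass n m → E n →L[ℝ] E n) :=
  isEmbedding_proj.continuous

instance : MeasurableSpace (Grass n m) := borel _
instance : BorelSpace (Grass n m) := ⟨rfl⟩

instance : SecondCountableTopology (Grass n m) := by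
  have : ProperSpace (E n →L[ℝ] E n) := FiniteDimensional.proper ℝ _
  exact isEmbedding_proj.secondCountableTopology

instance : T2Space (Grass n m) := isEmbedding_proj.t2Space

theorem trace_proj (S : Grass n m) :
    LinearMap.trace ℝ (E n) (proj S : E n →ₗ[ℝ] E n) = m := by
  have h : LinearMap.IsProj S.1 (proj S : E n →ₗ[ℝ] E n) :=
    ⟨fun x => Submodule.starProjection_apply_mem _ x,
      fun x hx => Submodule.starProjection_eq_self_iff.2 hx⟩
  have := h.trace
  rw [this, S.2]

theorem range_proj : range (proj : Grass n m → E n →L[ℝ] E n) =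
    {P : E n →L[ℝ] E n | IsStarProjection P} ∩
      {P : E n →L[ℝ] E n | LinearMap.trace ℝ (E n) (P : E n →ₗ[ℝ] E n) = m} := by
  ext P
  constructor
  · rintro ⟨S, rfl⟩
    exact ⟨isStarProjection_starProjection, trace_proj S⟩
  · rintro ⟨hP, ht⟩
    obtain ⟨S, _, hS⟩ := isStarProjection_iff_eq_starProjection.1 hP
    have hS' : P = S.starProjection := hS
    have h : LinearMap.IsProj S (S.starProjection : E n →ₗ[ℝ] E n) :=
      ⟨fun x => Submodule.starProjection_apply_mem _ x,
        fun x hx => Submodule.starProjection_eq_self_iff.2 hx⟩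
    have h2 := h.trace
    have ht' : LinearMap.trace ℝ (E n) (P : E n →ₗ[ℝ] E n) = m := ht
    rw [hS', h2] at ht'
    exact ⟨⟨S, by exact_mod_cast ht'⟩, hS'.symm⟩

instance : CompactSpace (Grass n m) := by
  have : ProperSpace (E n →L[ℝ] E n) := FiniteDimensional.proper ℝ _
  have hc : IsCompact (range (proj : Grass n m → E n →L[ℝ] E n)) := by
    apply Metric.isCompact_of_isClosed_isBounded
    · rw [range_proj]
      apply IsClosed.inter
      · have : {P : E n →L[ℝ] E n | IsStarProjection P} = {P | P * P = P} ∩ {P | star P = P} := by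
          ext P
          exact ⟨fun h => ⟨h.1, h.2⟩, fun h => ⟨h.1, h.2⟩⟩
        rw [this]
        exact (isClosed_eq (by fun_prop) (by fun_prop)).inter
          (isClosed_eq (ContinuousLinearMap.adjoint (𝕜 := ℝ) (E := E n) (F := E n)).continuous
            continuous_id)
      · refine isClosed_eq ?_ continuous_const
        exact ((LinearMap.trace ℝ (E n)) ∘ₗ
          ContinuousLinearMap.coeLM ℝ).continuous_of_finiteDimensional
    · refine (Metric.isBounded_closedBall (x := (0 : E n →L[ℝ] E n)) (r := 1)).subset ?_
      rintro _ ⟨S, rfl⟩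
      rw [mem_closedBall_zero_iff]
      exact Submodule.starProjection_norm_le S.1
  rw [← image_univ, ← isEmbedding_proj.isCompact_iff] at hc
  exact ⟨hc⟩

end Grass

/-! ### The total variation of a vector valued distribution -/

section Variation

variable {n : ℕ} {U : Opens (E n)}

/-- `sup {T(θ) : θ ∈ 𝓓(U, ℝⁿ), |θ| ≤ 1, spt θ ⊆ O}`. -/
def variationOn (T : 𝓓(U, E n) →ₗ[ℝ] ℝ) (O : Set U) : ℝ≥0∞ :=
  ⨆ θ : 𝓓(U, E n), ⨆ _ : (∀ x, ‖θ x‖ ≤ 1) ∧ tsupport θ ⊆ Subtype.val '' O, ENNReal.ofReal (T θ)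

theorem le_variationOn (T : 𝓓(U, E n) →ₗ[ℝ] ℝ) (O : Set U) (θ : 𝓓(U, E n))
    (h1 : ∀ x, ‖θ x‖ ≤ 1) (h2 : tsupport θ ⊆ Subtype.val '' O) :
    ENNReal.ofReal (T θ) ≤ variationOn T O :=
  le_iSup₂_of_le θ ⟨h1, h2⟩ le_rfl

theorem variationOn_mono (T : 𝓓(U, E n) →ₗ[ℝ] ℝ) {O O' : Set U} (h : O ⊆ O') :
    variationOn T O ≤ variationOn T O' :=
  iSup₂_le fun θ hθ => le_variationOn T O' θ hθ.1 (hθ.2.trans (image_mono h))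

theorem variationOn_empty (T : 𝓓(U, E n) →ₗ[ℝ] ℝ) : variationOn T ∅ = 0 := by
  refine le_antisymm (iSup₂_le fun θ hθ => ?_) bot_le
  have h : θ = 0 := by
    ext1 x
    have : tsupport θ = ∅ := by simpa using hθ.2
    rw [tsupport_eq_empty_iff] at this
    rw [this]; rfl
  simp [h]

theorem variationOn_iUnion_le (T : 𝓓(U, E n) →ₗ[ℝ] ℝ) (O : ℕ → Set U)
    (hO : ∀ i, IsOpen (O i)) : variationOn T (⋃ i, O i) ≤ ∑' i, variationOn T (O i) := by
  refine iSup₂_le fun θ hθ => ?_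
  obtain ⟨h1, h2⟩ := hθ
  have ho : ∀ i, IsOpen (Subtype.val '' (O i) : Set (E n)) := fun i =>
    U.isOpen.isOpenMap_subtype_val _ (hO i)
  have hcov : tsupport θ ⊆ ⋃ i, (Subtype.val '' (O i) : Set (E n)) := by
    rw [← image_iUnion]; exact h2
  obtain ⟨ρ, hρ⟩ := SmoothPartitionOfUnity.exists_isSubordinate (modelWithCornersSelf ℝ (E n))
    (isClosed_tsupport θ) (fun i => (Subtype.val '' (O i) : Set (E n))) ho hcov
  have hfin := ρ.locallyFinite.finite_nonempty_inter_compact θ.hasCompactSupport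
  let s : Finset ℕ := hfin.toFinset
  let ψ : ℕ → 𝓓(U, E n) := fun i =>
    { toFun := fun x => ρ i x • θ x
      contDiff' := ((ρ i).contMDiff.contDiff).smul θ.contDiff
      hasCompactSupport' := θ.hasCompactSupport.smul_left (f := fun x => ρ i x)
      tsupport_subset' :=
        (tsupport_smul_subset_right (fun x => ρ i x) θ).trans θ.tsupport_subset }
  have hψ : ∀ i x, ψ i x = ρ i x • θ x := fun i x => rfl
  have hsum : θ = ∑ i ∈ s, ψ i := by
    ext1 x
    have hev : (∑ i ∈ s, ψ i) x = ∑ i ∈ s, ψ i x := by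
      have : ∀ t : Finset ℕ, (∑ i ∈ t, ψ i) x = ∑ i ∈ t, ψ i x := by
        intro t
        induction t using Finset.induction_on with
        | empty => simp
        | insert a t ha ih =>
          rw [Finset.sum_insert ha, Finset.sum_insert ha, ← ih]; rfl
      exact this s
    rw [hev]
    simp_rw [hψ]
    rw [← Finset.sum_smul]
    by_cases hx : x ∈ tsupport θ
    · have hone := ρ.sum_eq_one hx
      have hsub : Function.support (fun i => ρ i x) ⊆ (s : Set ℕ) := by
        intro i hi
        have : ((Function.support fun y => ρ i y) ∩ tsupport θ).Nonempty := ⟨x, hi, hx⟩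
        simpa [s] using this
      rw [finsum_eq_sum_of_support_subset _ hsub] at hone
      rw [hone, one_smul]
    · rw [image_eq_zero_of_notMem_tsupport hx, smul_zero]
  calc ENNReal.ofReal (T θ) = ENNReal.ofReal (∑ i ∈ s, T (ψ i)) := by
        conv_lhs => rw [hsum]
        rw [map_sum]
    _ ≤ ∑ i ∈ s, ENNReal.ofReal (T (ψ i)) := by
        induction s using Finset.induction_on with
        | empty => simp
        | insert a t ha ih =>
          rw [Finset.sum_insert ha, Finset.sum_insert ha]
          exact ENNReal.ofReal_add_le.trans (by gcongr)
    _ ≤ ∑ i ∈ s, variationOn T (O i) := by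
        refine Finset.sum_le_sum fun i _ => le_variationOn T (O i) (ψ i) (fun x => ?_) ?_
        · rw [hψ, norm_smul, Real.norm_eq_abs, abs_of_nonneg (ρ.nonneg i x)]
          exact mul_le_one₀ (ρ.le_one i x) (norm_nonneg _) (h1 x)
        · exact (tsupport_smul_subset_left (fun x => ρ i x) θ).trans (hρ i)
    _ ≤ ∑' i, variationOn T (O i) := ENNReal.sum_le_tsum s

theorem variationOn_add_le (T : 𝓓(U, E n) →ₗ[ℝ] ℝ) {O O₁ O₂ : Set U}
    (h₁ : O₁ ⊆ O) (h₂ : O₂ ⊆ O) (hd : Disjoint O₁ O₂) :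
    variationOn T O₁ + variationOn T O₂ ≤ variationOn T O := by
  refine ENNReal.biSup_add_biSup_le' ⟨0, by simp [FunLike.coe_zero]⟩
    ⟨0, by simp [FunLike.coe_zero]⟩ ?_
  intro θ₁ hθ₁ θ₂ hθ₂
  rcases le_total (T θ₁) 0 with h | h
  · rw [ENNReal.ofReal_of_nonpos h, zero_add]
    exact (le_variationOn T O₂ θ₂ hθ₂.1 hθ₂.2).trans (variationOn_mono T h₂)
  rcases le_total (T θ₂) 0 with h' | h'
  · rw [ENNReal.ofReal_of_nonpos h', add_zero]
    exact (le_variationOn T O₁ θ₁ hθ₁.1 hθ₁.2).trans (variationOn_mono T h₁)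
  rw [← ENNReal.ofReal_add h h', ← map_add]
  refine le_variationOn T O _ (fun x => ?_) ?_
  · change ‖θ₁ x + θ₂ x‖ ≤ 1
    by_cases hx : x ∈ tsupport θ₁
    · have : x ∉ tsupport θ₂ := by
        intro hx'
        obtain ⟨y, hy, rfl⟩ := hθ₁.2 hx
        obtain ⟨z, hz, hzy⟩ := hθ₂.2 hx'
        rw [Subtype.val_injective hzy] at hz
        exact Set.disjoint_left.1 hd hy hz
      rw [image_eq_zero_of_notMem_tsupport this, add_zero]
      exact hθ₁.1 x
    · rw [image_eq_zero_of_notMem_tsupport hx, zero_add]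
      exact hθ₂.1 x
  · refine (tsupport_add θ₁ θ₂).trans (union_subset ?_ ?_)
    · exact hθ₁.2.trans (image_mono h₁)
    · exact hθ₂.2.trans (image_mono h₂)

/-- The total variation of `T` as an outer measure, `A ↦ inf {variationOn T O : A ⊆ O open}`. -/
def variationOuter (T : 𝓓(U, E n) →ₗ[ℝ] ℝ) : OuterMeasure U where
  measureOf A := ⨅ O : Set U, ⨅ _ : IsOpen O ∧ A ⊆ O, variationOn T O
  empty := le_antisymm
    ((iInf₂_le ∅ ⟨isOpen_empty, subset_rfl⟩).trans (variationOn_empty T).le) bot_le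
  mono h := le_iInf₂ fun O hO => iInf₂_le O ⟨hO.1, h.trans hO.2⟩
  iUnion_nat A _ := by
    refine ENNReal.le_of_forall_pos_le_add fun ε hε hlt => ?_
    obtain ⟨δ, hδ, hδs⟩ := ENNReal.exists_pos_sum_of_countable (ENNReal.coe_pos.2 hε).ne' ℕ
    have hA : ∀ i, ∃ O : Set U, (IsOpen O ∧ A i ⊆ O) ∧ variationOn T O ≤
        (⨅ O : Set U, ⨅ _ : IsOpen O ∧ A i ⊆ O, variationOn T O) + δ i := by
      intro i
      have hne : (⨅ O : Set U, ⨅ _ : IsOpen O ∧ A i ⊆ O, variationOn T O) ≠ ⊤ :=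
        ne_top_of_le_ne_top hlt.ne (ENNReal.le_tsum i)
      have := ENNReal.lt_add_right hne (ENNReal.coe_pos.2 (hδ i)).ne'
      simp only [iInf_lt_iff] at this
      obtain ⟨O, hO, h⟩ := this
      exact ⟨O, hO, h.le⟩
    choose O hO hle using hA
    calc (⨅ O : Set U, ⨅ _ : IsOpen O ∧ (⋃ i, A i) ⊆ O, variationOn T O)
        ≤ variationOn T (⋃ i, O i) :=
          iInf₂_le _ ⟨isOpen_iUnion fun i => (hO i).1, iUnion_mono fun i => (hO i).2⟩
      _ ≤ ∑' i, variationOn T (O i) := variationOn_iUnion_le T O fun i => (hO i).1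
      _ ≤ ∑' i, ((⨅ O : Set U, ⨅ _ : IsOpen O ∧ A i ⊆ O, variationOn T O) + δ i) :=
          ENNReal.tsum_le_tsum hle
      _ ≤ _ := by
          rw [ENNReal.tsum_add]
          gcongr

theorem variationOuter_isMetric (T : 𝓓(U, E n) →ₗ[ℝ] ℝ) : (variationOuter T).IsMetric := by
  rintro A B ⟨r, hr, hAB⟩
  refine le_antisymm (measure_union_le A B) (le_iInf₂ fun O hO => ?_)
  have hr2 : 0 < r / 2 := ENNReal.half_pos hr
  let O₁ : Set U := O ∩ ⋃ a ∈ A, Metric.eball a (r / 2)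
  let O₂ : Set U := O ∩ ⋃ b ∈ B, Metric.eball b (r / 2)
  have ho₁ : IsOpen O₁ := hO.1.inter (isOpen_biUnion fun _ _ => Metric.isOpen_eball)
  have ho₂ : IsOpen O₂ := hO.1.inter (isOpen_biUnion fun _ _ => Metric.isOpen_eball)
  have hs₁ : A ⊆ O₁ := fun a ha => ⟨hO.2 (Or.inl ha),
    mem_biUnion ha (Metric.mem_eball_self hr2)⟩
  have hs₂ : B ⊆ O₂ := fun a ha => ⟨hO.2 (Or.inr ha),
    mem_biUnion ha (Metric.mem_eball_self hr2)⟩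
  have hd : Disjoint O₁ O₂ := by
    rw [Set.disjoint_left]
    rintro x ⟨_, hx₁⟩ ⟨_, hx₂⟩
    simp only [mem_iUnion, Metric.mem_eball] at hx₁ hx₂
    obtain ⟨a, ha, hxa⟩ := hx₁
    obtain ⟨b, hb, hxb⟩ := hx₂
    have h1 := hAB a ha b hb
    have h2 : edist a b < r / 2 + r / 2 :=
      (edist_triangle_left a b x).trans_lt (ENNReal.add_lt_add hxa hxb)
    rw [ENNReal.add_halves] at h2
    exact absurd h1 (not_le.2 h2)
  calc variationOuter T A + variationOuter T B ≤ variationOn T O₁ + variationOn T O₂ :=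
        add_le_add (iInf₂_le O₁ ⟨ho₁, hs₁⟩) (iInf₂_le O₂ ⟨ho₂, hs₂⟩)
    _ ≤ variationOn T O := variationOn_add_le T inter_subset_left inter_subset_left hd

/-- The total variation measure `‖T‖` of `T` (on the Borel sets of `U`). -/
def variation (T : 𝓓(U, E n) →ₗ[ℝ] ℝ) : Measure U :=
  (variationOuter T).toMeasure (variationOuter_isMetric T).le_caratheodory

/-- `T(g) = c`, where `g` is `‖T‖`-integrable and `T` has been extended from `𝓓(U, ℝⁿ)` to
`L¹(‖T‖, ℝⁿ)` by continuity: `T(θ)` tends to `c` as the test function `θ` tends to `g` in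
`L¹(‖T‖, ℝⁿ)`. (If `‖T‖` is finite on compact sets then test functions are dense in
`L¹(‖T‖, ℝⁿ)`, so that there is exactly one such `c` for every integrable `g`.) -/
def ExtEq (T : 𝓓(U, E n) →ₗ[ℝ] ℝ) (g : U → E n) (c : ℝ) : Prop :=
  Integrable g (variation T) ∧
    Tendsto T (comap (fun θ : 𝓓(U, E n) => ∫⁻ x : U, ‖θ x - g x‖ₑ ∂(variation T)) (𝓝 0)) (𝓝 c)

end Variation

/-! ### Varifolds -/

/-- An `m`-dimensional varifold in `U`: a Radon measure on `U × G(n, m)`, that is, a Borel measure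
which is finite on compact sets (regularity is automatic, since `U × G(n, m)` is locally compact
and second countable). -/
structure Varifold {n : ℕ} (m : ℕ) (U : Opens (E n)) where
  /-- the underlying measure -/
  μ : Measure (U × Grass n m)
  finite_compact : IsFiniteMeasureOnCompacts μ

namespace Varifold

variable {n m : ℕ} {U : Opens (E n)}

instance (V : Varifold m U) : IsFiniteMeasureOnCompacts V.μ := V.finite_compact

/-- The weight `‖V‖`, `‖V‖(A) = V(A × G(n, m))`. -/
def weight (V : Varifold m U) : Measure U := V.μ.map Prod.fst

/-- `V ⌞ A`, the restriction of `V` to `A × G(n, m)`. -/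
def restrict (V : Varifold m U) (A : Set U) : Varifold m U where
  μ := V.μ.restrict (A ×ˢ univ)
  finite_compact := ⟨fun _ hK =>
    (Measure.restrict_apply_le _ _).trans_lt hK.measure_lt_top⟩

/-- `P • Dθ(x) = trace (P ∘ Dθ(x))`, the divergence of `θ` at `x` along the plane `S`, where `P` is
the orthogonal projection onto `S`. -/
def planeDiv (S : Grass n m) (θ : E n → E n) (x : E n) : ℝ :=
  LinearMap.trace ℝ (E n) (S.proj ∘L fderiv ℝ θ x : E n →L[ℝ] E n)

theorem continuous_planeDiv (θ : 𝓓(U, E n)) :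
    Continuous fun p : U × Grass n m => planeDiv p.2 θ p.1 := by
  have h1 : Continuous fun A : E n →L[ℝ] E n => LinearMap.trace ℝ (E n) (A : E n →ₗ[ℝ] E n) :=
    ((LinearMap.trace ℝ (E n)) ∘ₗ ContinuousLinearMap.coeLM ℝ).continuous_of_finiteDimensional
  have h2 : Continuous (fderiv ℝ θ) := θ.contDiff.continuous_fderiv (by simp)
  refine h1.comp (Continuous.clm_comp (Grass.continuous_proj.comp continuous_snd) ?_)
  exact h2.comp (continuous_subtype_val.comp continuous_fst)

theorem integrable_planeDiv (V : Varifold m U) (θ : 𝓓(U, E n)) :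
    Integrable (fun p : U × Grass n m => planeDiv p.2 θ p.1) V.μ := by
  refine (continuous_planeDiv θ).integrable_of_hasCompactSupport ?_
  have hK : IsCompact ((Subtype.val : U → E n) ⁻¹' (tsupport θ)) := by
    refine U.isOpen.isOpenEmbedding_subtypeVal.isInducing.isCompact_preimage' θ.hasCompactSupport ?_
    simpa using θ.tsupport_subset
  refine HasCompactSupport.intro (hK.prod isCompact_univ) ?_
  rintro ⟨x, S⟩ hx
  have hx' : (x : E n) ∉ tsupport θ := fun h => hx ⟨h, mem_univ _⟩
  have : fderiv ℝ θ (x : E n) = 0 := by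
    by_contra h
    exact hx' (support_fderiv_subset ℝ h)
  simp [planeDiv, this]

/-- The first variation `δV(θ) = ∫ P • Dθ(x) dV(x, P)`. -/
def firstVariation (V : Varifold m U) : 𝓓(U, E n) →ₗ[ℝ] ℝ where
  toFun θ := ∫ p : U × Grass n m, planeDiv p.2 θ p.1 ∂V.μ
  map_add' θ η := by
    rw [← integral_add (integrable_planeDiv V θ) (integrable_planeDiv V η)]
    refine integral_congr_ae (Eventually.of_forall fun p => ?_)
    have h : fderiv ℝ (⇑(θ + η)) (p.1 : E n) = fderiv ℝ θ (p.1 : E n) + fderiv ℝ η (p.1 : E n) := by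
      rw [FunLike.coe_add]
      exact fderiv_add ((θ.contDiff.differentiable (by simp)).differentiableAt)
        ((η.contDiff.differentiable (by simp)).differentiableAt)
    simp only [planeDiv, h, ContinuousLinearMap.comp_add]
    simp
  map_smul' c θ := by
    rw [RingHom.id_apply, smul_eq_mul, ← integral_const_mul]
    refine integral_congr_ae (Eventually.of_forall fun p => ?_)
    have h : fderiv ℝ (⇑(c • θ)) (p.1 : E n) = c • fderiv ℝ θ (p.1 : E n) := by
      rw [FunLike.coe_smul]
      exact fderiv_const_smul ((θ.contDiff.differentiable (by simp)).differentiableAt) c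
    simp only [planeDiv, h, ContinuousLinearMap.comp_smul]
    simp

/-- The total variation measure `‖δV‖` of the first variation. -/
def varMeasure (V : Varifold m U) : Measure U := variation V.firstVariation

/-- `‖δV‖` is a Radon measure. -/
def RadonVariation (V : Varifold m U) : Prop := IsFiniteMeasureOnCompacts V.varMeasure

/-- `V ∂ A = 0`, where the distributional boundary of `A` with respect to `V` is
`V ∂ A = (δV) ⌞ A - δ(V ⌞ A)`, and `((δV) ⌞ A)(θ)` is the value of (the extension to
`L¹(‖δV‖, ℝⁿ)` of) `δV` at `1_A θ`. -/
def ZeroBoundary (V : Varifold m U) (A : Set U) : Prop :=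
  ∀ θ : 𝓓(U, E n),
    ExtEq V.firstVariation (A.indicator fun x => θ x) ((V.restrict A).firstVariation θ)

/-- `Π` is a partition of `V`. -/
structure IsPartition (V : Varifold m U) (Pi : Set (Varifold m U)) : Prop where
  component : ∀ W ∈ Pi, ∃ A : Set U, NullMeasurableSet A (V.weight + V.varMeasure) ∧
    0 < V.weight A ∧ V.ZeroBoundary A ∧ W = V.restrict A
  sum_measure : ∀ β : C_c(U × Grass n m, ℝ),
    HasSum (fun W : Pi => ∫ p, β p ∂W.1.μ) (∫ p, β p ∂V.μ)
  sum_variation : ∀ φ : C_c(U, ℝ),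
    HasSum (fun W : Pi => ∫ x, φ x ∂W.1.varMeasure) (∫ x, φ x ∂V.varMeasure)

/-- `W` is a partitioned component of `V`: a member of some partition of `V`. -/
def IsPartitionedComponent (V W : Varifold m U) : Prop :=
  ∃ Pi : Set (Varifold m U), V.IsPartition Pi ∧ W ∈ Pi

/-- `f` is generalised `V`-weakly differentiable (for `V` with `‖δV‖` a Radon measure), with
generalised weak derivative `F`. A function which is only defined almost everywhere is represented
by an arbitrary extension to all of `U`. -/
structure HasWeakDeriv {Y : Type*} [NormedAddCommGroup Y] [NormedSpace ℝ Y]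
    (V : Varifold m U) (f : U → Y) (F : U → E n →L[ℝ] Y) : Prop where
  aestronglyMeasurable : AEStronglyMeasurable f (V.weight + V.varMeasure)
  aestronglyMeasurable_deriv : AEStronglyMeasurable F V.weight
  integrableOn_deriv : ∀ (C : Set U) (s : ℝ), IsCompact C → 0 ≤ s →
    IntegrableOn F (C ∩ {x | ‖f x‖ ≤ s}) V.weight
  identity : ∀ (θ : 𝓓(U, E n)) (γ : Y → ℝ), ContDiff ℝ ∞ γ → HasCompactSupport (fderiv ℝ γ) →
    ExtEq V.firstVariation (fun x => γ (f x) • θ x)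
      ((∫ p : U × Grass n m, γ (f p.1) * planeDiv p.2 θ p.1 ∂V.μ) +
        ∫ x : U, fderiv ℝ γ (f x) (F x (θ x)) ∂V.weight)

/-- The class of generalised `V`-weakly differentiable functions with values in `Y`. -/
def WeaklyDiff {Y : Type*} [NormedAddCommGroup Y] [NormedSpace ℝ Y]
    (V : Varifold m U) (f : U → Y) : Prop :=
  ∃ F : U → E n →L[ℝ] Y, V.HasWeakDeriv f F

end Varifold

end VarifoldTheory

end

noncomputable section

namespace VarifoldTheory

/-! Since `K` is compact and disjoint from the closed set `D`, there is a smooth cutoff `ζ` on `Y`,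
compactly supported in `Dᶜ`, with `ζ = 1` near `K`. As `f` takes values in `D ∪ K` almost
everywhere, `ζ ∘ f` is the indicator of `f⁻¹(K)` for `‖V‖`-almost every point and, by absolute
continuity, for `‖δV‖`-almost every point. Moreover `Dζ` vanishes at almost every value of `f`.
Hence for every smooth `γ` the product `γζ` is admissible in the identity defining weak
differentiability, and inserting it restricts both sides to `f⁻¹(K)`
(`HasWeakDeriv.identity_indicator`). The case `γ = 1` says that `f⁻¹(K)` has zero boundary.

The rest is measure theory for the continuous extension of a distribution `T` to `L¹(‖T‖)`. If
`T'(θ) = T(1_A θ)` for all test functions, then `‖T'‖ = ‖T‖ ⌞ A` (`ExtEq.variation_eq_restrict`),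
and the extension of `T'` at `g` is that of `T` at `1_A g` (`ExtEq.of_indicator`). Applied to `δV`,
the first fact shows that `‖δV‖` splits over `A` and its complement, so that the restrictions of `V`
to these two sets form a partition. The second turns the localised identity into weak
differentiability of `f` with respect to `V ⌞ A`, with the same derivative. -/

/-- Smooth Urysohn lemma: a smooth function with values in `[0, 1]` and compact support in the open
set `O` which equals `1` near the compact set `C`. -/
theorem exists_contDiff_one_nhdsSet {X : Type*} [NormedAddCommGroup X] [NormedSpace ℝ X]
    [FiniteDimensional ℝ X] {C O : Set X} (hC : IsCompact C) (hO : IsOpen O) (hCO : C ⊆ O) :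
    ∃ ρ : X → ℝ, ContDiff ℝ ∞ ρ ∧ HasCompactSupport ρ ∧ tsupport ρ ⊆ O ∧
      (∀ᶠ x in 𝓝ˢ C, ρ x = 1) ∧ ∀ x, ρ x ∈ Icc 0 1 := by
  have : ProperSpace X := FiniteDimensional.proper ℝ X
  obtain ⟨G, hGo, hCG, hGO, hGc⟩ := exists_open_between_and_isCompact_closure hC hO hCO
  obtain ⟨ρ, h1, h0, hρ⟩ := exists_contMDiffMap_one_nhds_of_subset_interior
    (modelWithCornersSelf ℝ X) (n := ⊤) hC.isClosed
    (hCG.trans_eq hGo.interior_eq.symm)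
  have hsub : tsupport ρ ⊆ closure G :=
    closure_mono fun x hx => by_contra fun h => hx (h0 x h)
  exact ⟨ρ, ρ.contMDiff.contDiff, hGc.of_isClosed_subset (isClosed_tsupport _) hsub,
    hsub.trans hGO, h1, hρ⟩

/-! ### Total variation and approximation of `1_A θ` by test functions -/

section Variation

variable {n : ℕ} {U : Opens (E n)}

instance : LocallyCompactSpace U := U.isOpen.locallyCompactSpace

theorem variation_of_isOpen (T : 𝓓(U, E n) →ₗ[ℝ] ℝ) {O : Set U} (hO : IsOpen O) :
    variation T O = variationOn T O := by
  rw [variation, toMeasure_apply _ _ hO.measurableSet]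
  exact le_antisymm (iInf₂_le O ⟨hO, subset_rfl⟩)
    (le_iInf₂ fun O' hO' => variationOn_mono T hO'.2)

theorem variation_of_measurableSet (T : 𝓓(U, E n) →ₗ[ℝ] ℝ) {A : Set U} (hA : MeasurableSet A) :
    variation T A = ⨅ O : Set U, ⨅ _ : IsOpen O ∧ A ⊆ O, variationOn T O := by
  rw [variation, toMeasure_apply _ _ hA]
  rfl

/-- A measure which is finite on compact sets dominates `‖T‖` if it does so on open sets. -/
theorem variation_le_of_isOpen (T : 𝓓(U, E n) →ₗ[ℝ] ℝ) (ν : Measure U)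
    [IsFiniteMeasureOnCompacts ν] (h : ∀ O : Set U, IsOpen O → variationOn T O ≤ ν O) :
    variation T ≤ ν := by
  refine Measure.le_iff.2 fun A hA => ?_
  rw [variation_of_measurableSet T hA, A.measure_eq_iInf_isOpen ν]
  exact le_iInf₂ fun O hAO => le_iInf fun hO => (iInf₂_le O ⟨hO, hAO⟩).trans (h O hO)

theorem isCompact_preimage_tsupport (θ : 𝓓(U, E n)) :
    IsCompact ((Subtype.val : U → E n) ⁻¹' (tsupport θ)) := by
  refine U.isOpen.isOpenEmbedding_subtypeVal.isInducing.isCompact_preimage' θ.hasCompactSupport ?_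
  simpa using θ.tsupport_subset

theorem continuous_testFunction (θ : 𝓓(U, E n)) : Continuous fun x : U => θ x :=
  θ.contDiff.continuous.comp continuous_subtype_val

theorem integrable_testFunction (ν : Measure U) [IsFiniteMeasureOnCompacts ν] (θ : 𝓓(U, E n)) :
    Integrable (fun x : U => θ x) ν :=
  (continuous_testFunction θ).integrable_of_hasCompactSupport <|
    HasCompactSupport.intro (isCompact_preimage_tsupport θ) fun _ hx =>
      image_eq_zero_of_notMem_tsupport hx

/-- The product of a smooth function and a test function. -/
def smulTest (ρ : E n → ℝ) (hρ : ContDiff ℝ ∞ ρ) (θ : 𝓓(U, E n)) : 𝓓(U, E n) where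
  toFun x := ρ x • θ x
  contDiff' := hρ.smul θ.contDiff
  hasCompactSupport' := θ.hasCompactSupport.smul_left (f := ρ)
  tsupport_subset' := (tsupport_smul_subset_right ρ θ).trans θ.tsupport_subset

theorem smulTest_apply (ρ : E n → ℝ) (hρ : ContDiff ℝ ∞ ρ) (θ : 𝓓(U, E n)) (x : E n) :
    smulTest ρ hρ θ x = ρ x • θ x := rfl

/-- `1_A θ` can be approximated in `L¹` by test functions supported near `A`. -/
theorem exists_testFunction_near_indicator (ν : Measure U) [IsFiniteMeasureOnCompacts ν]
    {A : Set U} (hA : MeasurableSet A) (θ : 𝓓(U, E n)) {O : Set U} (hO : IsOpen O)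
    (hAO : ∀ x ∈ A, (x : E n) ∈ tsupport θ → x ∈ O) {ε : ℝ≥0∞} (hε : ε ≠ 0) :
    ∃ η : 𝓓(U, E n), (∀ x, ‖η x‖ ≤ ‖θ x‖) ∧ tsupport η ⊆ Subtype.val '' O ∧
      ∫⁻ x : U, ‖η x - A.indicator (fun x : U => θ x) x‖ₑ ∂ν ≤ ε := by
  obtain ⟨M, hM⟩ := θ.hasCompactSupport.exists_bound_of_continuous θ.contDiff.continuous
  -- Adding `1` keeps the bound nonzero, so that one may divide by it. The approximation error will
  -- be at most `N` and will live on two sets of measure less than `δ = ε / N / 2`.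
  set N : ℝ≥0∞ := ENNReal.ofReal M + 1 with hN
  have hN0 : N ≠ 0 := by simp [hN]
  have hNt : N ≠ ⊤ := by simp [hN]
  have hMN : ∀ x, ‖θ x‖ₑ ≤ N := fun x => by
    rw [← ofReal_norm]
    exact (ENNReal.ofReal_le_ofReal (hM x)).trans le_self_add
  set δ : ℝ≥0∞ := ε / N / 2 with hδ
  have hδ0 : δ ≠ 0 := by simp [hδ, hε, hNt]
  -- Intersecting with the support of `θ` does not change `1_A θ` and gives a set of finite measure.
  -- It can therefore be squeezed between a compact `C` and an open `G`, and the cutoff is `1` on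
  -- `C` and `0` off `G`.
  set B : Set U := A ∩ Subtype.val ⁻¹' (tsupport θ) with hB
  have hBm : MeasurableSet B :=
    hA.inter ((isClosed_tsupport θ).preimage continuous_subtype_val).measurableSet
  have hBt : ν B ≠ ⊤ := ne_top_of_le_ne_top (isCompact_preimage_tsupport θ).measure_lt_top.ne
    (measure_mono inter_subset_right)
  obtain ⟨C, hCB, hC, hνC⟩ := hBm.exists_isCompact_sdiff_lt hBt hδ0
  obtain ⟨G, hBG, hG, -, hνG⟩ := hBm.exists_isOpen_sdiff_lt hBt hδ0
  have hGO : IsOpen (Subtype.val '' (G ∩ O) : Set (E n)) :=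
    U.isOpen.isOpenMap_subtype_val _ (hG.inter hO)
  obtain ⟨ρ, hρ, -, hρs, hρ1, hρ01⟩ := exists_contDiff_one_nhdsSet
    (hC.image continuous_subtype_val) hGO
    (image_mono fun x hx => ⟨hBG (hCB hx), hAO x (hCB hx).1 (hCB hx).2⟩)
  refine ⟨smulTest ρ hρ θ, fun x => ?_, ?_, ?_⟩
  · rw [smulTest_apply, norm_smul, Real.norm_of_nonneg (hρ01 x).1]
    exact mul_le_of_le_one_left (norm_nonneg _) (hρ01 x).2
  · exact (tsupport_smul_subset_left ρ θ).trans (hρs.trans (image_mono inter_subset_right))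
  have hρC : ∀ x ∈ C, ρ x = 1 := fun x hx => hρ1.self_of_nhdsSet _ (mem_image_of_mem _ hx)
  have hρG : ∀ x : U, x ∉ G → ρ x = 0 := fun x hx => by
    refine image_eq_zero_of_notMem_tsupport fun h => ?_
    obtain ⟨y, hy, hyx⟩ := hρs h
    exact hx (Subtype.val_injective hyx ▸ hy.1)
  have hpt : ∀ x : U, ‖smulTest ρ hρ θ x - A.indicator (fun x : U => θ x) x‖ₑ ≤
      ((G \ B) ∪ (B \ C)).indicator (fun _ => N) x := by
    intro x
    rw [smulTest_apply]
    by_cases hx : x ∈ (G \ B) ∪ (B \ C)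
    · rw [indicator_of_mem hx]
      refine le_trans ?_ (hMN x)
      by_cases hxA : x ∈ A
      · rw [indicator_of_mem hxA, ← ofReal_norm, ← ofReal_norm]
        refine ENNReal.ofReal_le_ofReal ?_
        have : ρ x • θ x - θ x = (ρ x - 1) • θ x := by rw [sub_smul, one_smul]
        rw [this, norm_smul, Real.norm_eq_abs]
        refine mul_le_of_le_one_left (norm_nonneg _) (abs_le.2 ?_)
        have := hρ01 (x : E n)
        constructor <;> linarith [this.1, this.2]
      · rw [indicator_of_notMem hxA, sub_zero, ← ofReal_norm, ← ofReal_norm]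
        refine ENNReal.ofReal_le_ofReal ?_
        rw [norm_smul, Real.norm_of_nonneg (hρ01 _).1]
        exact mul_le_of_le_one_left (norm_nonneg _) (hρ01 _).2
    · rw [indicator_of_notMem hx]
      simp only [mem_union, Set.mem_sdiff, not_or, not_and, not_not] at hx
      refine (enorm_eq_zero.2 ?_).le
      by_cases hxB : x ∈ B
      · rw [indicator_of_mem hxB.1, hρC x (hx.2 hxB), one_smul, sub_self]
      · rw [hρG x fun h => hxB (hx.1 h), zero_smul, zero_sub, neg_eq_zero]
        by_cases hxA : x ∈ A
        · rw [indicator_of_mem hxA]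
          exact image_eq_zero_of_notMem_tsupport fun h => hxB ⟨hxA, h⟩
        · exact indicator_of_notMem hxA _
  calc ∫⁻ x : U, ‖smulTest ρ hρ θ x - A.indicator (fun x : U => θ x) x‖ₑ ∂ν
      ≤ ∫⁻ x : U, ((G \ B) ∪ (B \ C)).indicator (fun _ => N) x ∂ν := lintegral_mono hpt
    _ ≤ N * ν ((G \ B) ∪ (B \ C)) := lintegral_indicator_const_le _ _
    _ ≤ N * (δ + δ) := by
        gcongr
        exact (measure_union_le _ _).trans (add_le_add hνG.le hνC.le)
    _ = ε := by
        rw [hδ, ENNReal.add_halves, ENNReal.mul_div_cancel hN0 hNt]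

theorem exists_seq_testFunction_tendsto_indicator (ν : Measure U) [IsFiniteMeasureOnCompacts ν]
    {A : Set U} (hA : MeasurableSet A) (θ : 𝓓(U, E n)) {O : Set U} (hO : IsOpen O)
    (hAO : ∀ x ∈ A, (x : E n) ∈ tsupport θ → x ∈ O) :
    ∃ η : ℕ → 𝓓(U, E n), (∀ k x, ‖η k x‖ ≤ ‖θ x‖) ∧ (∀ k, tsupport (η k) ⊆ Subtype.val '' O) ∧
      Tendsto (fun k => ∫⁻ x : U, ‖η k x - A.indicator (fun x : U => θ x) x‖ₑ ∂ν)
        atTop (𝓝 0) := by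
  -- For `k = 0` the inverse is `∞`, which is a harmless error bound.
  have h : ∀ k : ℕ, ((k : ℝ≥0∞))⁻¹ ≠ 0 := fun k => by simp
  choose η h1 h2 h3 using fun k => exists_testFunction_near_indicator ν hA θ hO hAO (h k)
  exact ⟨η, h1, h2, tendsto_of_tendsto_of_tendsto_of_le_of_le tendsto_const_nhds
    ENNReal.tendsto_inv_nat_nhds_zero (fun _ => bot_le) h3⟩

/-! ### Restricting a distribution to a measurable set -/

namespace ExtEq

variable {T T' : 𝓓(U, E n) →ₗ[ℝ] ℝ} {g g' : U → E n} {c c' : ℝ} {A : Set U}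

theorem congr_ae (h : ExtEq T g c) (hg : g =ᵐ[variation T] g') : ExtEq T g' c := by
  refine ⟨h.1.congr hg, ?_⟩
  have : (fun θ : 𝓓(U, E n) => ∫⁻ x : U, ‖θ x - g' x‖ₑ ∂(variation T)) =
      fun θ : 𝓓(U, E n) => ∫⁻ x : U, ‖θ x - g x‖ₑ ∂(variation T) := by
    ext θ
    refine lintegral_congr_ae ?_
    filter_upwards [hg] with x hx
    rw [hx]
  rw [this]
  exact h.2

theorem tendsto_of_tendsto {ι : Type*} {l : Filter ι} (h : ExtEq T g c) {η : ι → 𝓓(U, E n)}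
    (hη : Tendsto (fun k => ∫⁻ x : U, ‖η k x - g x‖ₑ ∂(variation T)) l (𝓝 0)) :
    Tendsto (fun k => T (η k)) l (𝓝 c) :=
  h.2.comp (tendsto_comap_iff.2 hη)

/-- If `T(1_A θ) = T'(θ)`, then `T(1_{Aᶜ} θ) = (T - T')(θ)`. -/
theorem indicator_compl [IsFiniteMeasureOnCompacts (variation T)] (hA : MeasurableSet A)
    {θ : 𝓓(U, E n)} (h : ExtEq T (A.indicator fun x => θ x) c) :
    ExtEq T (Aᶜ.indicator fun x => θ x) (T θ - c) := by
  refine ⟨(integrable_testFunction _ θ).indicator hA.compl, ?_⟩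
  -- The map `η ↦ θ - η` exchanges approximations of `1_{Aᶜ} θ` and of `1_A θ`: since the two
  -- indicators add up to `θ`, the errors differ only by sign.
  have h2 : Tendsto (fun η : 𝓓(U, E n) => T (θ - η))
      (comap (fun η : 𝓓(U, E n) =>
        ∫⁻ x : U, ‖η x - Aᶜ.indicator (fun x => θ x) x‖ₑ ∂(variation T)) (𝓝 0)) (𝓝 c) := by
    refine h.tendsto_of_tendsto ?_
    refine (tendsto_comap (f := fun η : 𝓓(U, E n) =>
        ∫⁻ x : U, ‖η x - Aᶜ.indicator (fun x => θ x) x‖ₑ ∂(variation T))).congr fun η => ?_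
    refine lintegral_congr fun x => ?_
    have h3 : (θ - η) x = θ x - η x := rfl
    rw [h3, ← enorm_neg]
    congr 1
    have h4 := congrFun (indicator_self_add_compl A fun x : U => θ x) x
    rw [Pi.add_apply] at h4
    rw [← h4]
    abel
  have h5 := h2.const_sub (T θ)
  simpa using h5

/-- For `θ` supported in `O` and any open `G ⊇ O ∩ A`, the function `1_A θ` is an `L¹` limit of test
functions supported in `G` and no larger than `θ`. So `T'(θ)` is a limit of values bounded by the
variation of `T` on `G`, and one takes the infimum over `G`. -/
theorem variationOn_le [IsFiniteMeasureOnCompacts (variation T)] (hA : MeasurableSet A)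
    (h : ∀ θ : 𝓓(U, E n), ExtEq T (A.indicator fun x => θ x) (T' θ)) {O : Set U}
    (hO : IsOpen O) : variationOn T' O ≤ variation T (O ∩ A) := by
  rw [variation_of_measurableSet T (hO.measurableSet.inter hA)]
  refine iSup₂_le fun θ hθ => le_iInf₂ fun G hG => ?_
  obtain ⟨η, h1, h2, h3⟩ := exists_seq_testFunction_tendsto_indicator (variation T) hA θ hG.1
    (fun x hxA hx => hG.2 ⟨by
      obtain ⟨y, hy, hyx⟩ := hθ.2 hx
      exact Subtype.val_injective hyx ▸ hy, hxA⟩)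
  refine le_of_tendsto ((ENNReal.continuous_ofReal.tendsto _).comp
    ((h θ).tendsto_of_tendsto h3)) (Eventually.of_forall fun k => ?_)
  exact le_variationOn T G (η k) (fun x => (h1 k x).trans (hθ.1 x)) (h2 k)

/-- If `T'(θ) = T(1_A θ)` for all test functions, then `‖T'‖ = ‖T‖ ⌞ A`. -/
theorem variation_eq_restrict [IsFiniteMeasureOnCompacts (variation T)] (hA : MeasurableSet A)
    (h : ∀ θ : 𝓓(U, E n), ExtEq T (A.indicator fun x => θ x) (T' θ)) :
    variation T' = (variation T).restrict A := by
  -- The upper bound is stated for a general set because it is applied to `A` with `T'` and to `Aᶜ`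
  -- with `T - T'`. The reverse inequality comes from subadditivity of the variation, since `‖T -
  -- T'‖` does not charge `A`.
  have key : ∀ {B : Set U} {S : 𝓓(U, E n) →ₗ[ℝ] ℝ}, MeasurableSet B →
      (∀ θ : 𝓓(U, E n), ExtEq T (B.indicator fun x => θ x) (S θ)) →
      variation S ≤ (variation T).restrict B := fun {B S} hB hS =>
    variation_le_of_isOpen _ _ fun O hO => by
      rw [Measure.restrict_apply hO.measurableSet]
      exact variationOn_le hB hS hO
  have h1 := key hA h
  have h2 : variation (T - T') ≤ (variation T).restrict Aᶜ :=
    key hA.compl fun θ => (h θ).indicator_compl hA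
  -- Local finiteness of the sum supplies the outer regularity needed to pass from open sets to
  -- Borel sets in `h3`.
  have hfin : IsFiniteMeasureOnCompacts (variation T' + variation (T - T')) := by
    refine ⟨fun C hC => (Measure.le_iff'.1 (add_le_add h1 h2) C).trans_lt ?_⟩
    rw [Measure.restrict_add_restrict_compl hA]
    exact hC.measure_lt_top
  have h3 : variation T ≤ variation T' + variation (T - T') := by
    refine variation_le_of_isOpen _ _ fun O hO => iSup₂_le fun θ hθ => ?_
    rw [Measure.add_apply, variation_of_isOpen _ hO, variation_of_isOpen _ hO]
    have : T θ = T' θ + (T - T') θ := by simp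
    rw [this]
    exact ENNReal.ofReal_add_le.trans
      (add_le_add (le_variationOn _ _ _ hθ.1 hθ.2) (le_variationOn _ _ _ hθ.1 hθ.2))
  refine le_antisymm h1 (Measure.le_iff.2 fun S hS => ?_)
  rw [Measure.restrict_apply hS]
  have h4 : variation (T - T') (S ∩ A) = 0 := by
    refine le_antisymm ((Measure.le_iff'.1 h2 _).trans ?_) bot_le
    rw [Measure.restrict_apply (hS.inter hA), inter_assoc, inter_compl_self, inter_empty,
      measure_empty]
  calc variation T (S ∩ A) ≤ (variation T' + variation (T - T')) (S ∩ A) := Measure.le_iff'.1 h3 _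
    _ = variation T' (S ∩ A) := by rw [Measure.add_apply, h4, add_zero]
    _ ≤ variation T' S := measure_mono inter_subset_left

/-- If `T'(θ) = T(1_A θ)` for all test functions, then `T'(g) = T(1_A g)` for all `g`. -/
theorem of_indicator [IsFiniteMeasureOnCompacts (variation T)] (hA : MeasurableSet A)
    (h : ∀ θ : 𝓓(U, E n), ExtEq T (A.indicator fun x => θ x) (T' θ))
    (hg : ExtEq T (A.indicator g) c) : ExtEq T' g c := by
  have hv := variation_eq_restrict hA h
  refine ⟨by rw [hv]; exact (integrable_indicator_iff hA).1 hg.1, ?_⟩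
  rw [hv]
  -- Closed neighbourhoods of `c` are used because `T'(θ)` is reached only as a limit. If `θ` is
  -- `r`-close to `g` in `L¹(‖T‖ ⌞ A)` and `η k` tends to `1_A θ`, the triangle inequality makes `η
  -- k` eventually `r`-close to `1_A g`. Then `T(η k)` lies in `F`, and so does its limit `T'(θ)`.
  refine (closed_nhds_basis c).tendsto_right_iff.2 fun F hF => ?_
  have h1 := hg.2 hF.1
  rw [mem_map, mem_comap] at h1
  obtain ⟨t, ht, hts⟩ := h1
  obtain ⟨r, hr, hrt⟩ := ENNReal.nhds_zero_basis.mem_iff.1 ht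
  refine mem_comap.2 ⟨Iio r, Iio_mem_nhds hr, fun θ hθ => ?_⟩
  obtain ⟨η, -, -, h3⟩ := exists_seq_testFunction_tendsto_indicator (variation T) hA θ
    isOpen_univ fun _ _ _ => mem_univ _
  refine hF.2.mem_of_tendsto ((h θ).tendsto_of_tendsto h3) ?_
  have hθ' : ∫⁻ x in A, ‖θ x - g x‖ₑ ∂(variation T) < r := hθ
  have h4 : Tendsto (fun k => (∫⁻ x : U, ‖η k x - A.indicator (fun x : U => θ x) x‖ₑ
      ∂(variation T)) + ∫⁻ x in A, ‖θ x - g x‖ₑ ∂(variation T)) atTop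
      (𝓝 (0 + ∫⁻ x in A, ‖θ x - g x‖ₑ ∂(variation T))) := h3.add tendsto_const_nhds
  rw [zero_add] at h4
  filter_upwards [h4.eventually_lt_const hθ'] with k hk
  refine hts (hrt (lt_of_le_of_lt ?_ hk))
  rw [← lintegral_indicator hA, ← lintegral_add_left]
  · refine lintegral_mono fun x => ?_
    by_cases hx : x ∈ A
    · simp only [indicator_of_mem hx]
      exact (enorm_add_le _ _).trans_eq' (by congr 1; abel)
    · simp [indicator_of_notMem hx]
  · exact ((continuous_testFunction (η k)).measurable.sub
      ((continuous_testFunction θ).measurable.indicator hA)).enorm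

end ExtEq

end Variation

/-! ### Restricted varifolds, zero boundary and partitions -/

theorem hasSum_pair {α : Type*} {a b : α} (hab : a ≠ b) (g : α → ℝ) :
    HasSum (fun x : ({a, b} : Set α) => g x) (g a + g b) :=
  HasSum.add_disjoint (s := {a}) (t := {b}) (f := g) (disjoint_singleton.2 hab)
    (hasSum_singleton a g) (hasSum_singleton b g)

namespace Varifold

variable {n m : ℕ} {U : Opens (E n)} {V W : Varifold m U} {A B : Set U}

theorem ext_measure (h : V.μ = W.μ) : V = W := by
  cases V; cases W; cases h; rfl

theorem ae_of_ae_weight {p : U → Prop} (h : ∀ᵐ x ∂V.weight, p x) : ∀ᵐ z ∂V.μ, p z.1 :=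
  ae_of_ae_map measurable_fst.aemeasurable h

theorem restrict_congr (h : A =ᵐ[V.weight] B) : V.restrict A = V.restrict B := by
  refine ext_measure (Measure.restrict_congr_set ?_)
  filter_upwards [ae_of_ae_weight h] with z hz
  have hz' : (z.1 ∈ A) = (z.1 ∈ B) := hz
  exact propext (and_congr_left' (Iff.of_eq hz'))

theorem restrict_univ : V.restrict univ = V :=
  ext_measure (by simp [restrict])

theorem weight_restrict (hA : MeasurableSet A) : (V.restrict A).weight = V.weight.restrict A := by
  rw [weight, weight, Measure.restrict_map measurable_fst hA, ← prod_univ]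
  rfl

/-- Two null-set conditions are needed: the weight determines `V ⌞ A`, while `‖δV‖` determines the
class of `1_A θ` in `L¹`. -/
theorem ZeroBoundary.congr (h : V.ZeroBoundary A) (h1 : A =ᵐ[V.weight] B)
    (h2 : A =ᵐ[V.varMeasure] B) : V.ZeroBoundary B := fun θ => by
  rw [← restrict_congr h1]
  exact (h θ).congr_ae (indicator_ae_eq_of_ae_eq_set h2)

theorem ZeroBoundary.varMeasure_restrict (hV : V.RadonVariation) (hA : MeasurableSet A)
    (h : V.ZeroBoundary A) : (V.restrict A).varMeasure = V.varMeasure.restrict A :=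
  have : IsFiniteMeasureOnCompacts (variation V.firstVariation) := hV
  ExtEq.variation_eq_restrict hA h

theorem firstVariation_restrict_compl (hA : MeasurableSet A) (θ : 𝓓(U, E n)) :
    (V.restrict Aᶜ).firstVariation θ = V.firstVariation θ - (V.restrict A).firstVariation θ := by
  have h := integral_add_compl (hA.prod (MeasurableSet.univ (α := Grass n m)))
    (integrable_planeDiv V θ)
  have hc : (A ×ˢ (univ : Set (Grass n m)))ᶜ = Aᶜ ×ˢ univ := by
    ext; simp
  rw [hc] at h
  exact eq_sub_of_add_eq' h

theorem ZeroBoundary.compl (hV : V.RadonVariation) (hA : MeasurableSet A)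
    (h : V.ZeroBoundary A) : V.ZeroBoundary Aᶜ := fun θ => by
  have : IsFiniteMeasureOnCompacts (variation V.firstVariation) := hV
  rw [firstVariation_restrict_compl hA]
  exact (h θ).indicator_compl hA

/-- A set of positive weight with zero boundary defines a partitioned component. -/
theorem ZeroBoundary.isPartitionedComponent (hV : V.RadonVariation) (hA : MeasurableSet A)
    (h : V.ZeroBoundary A) (hpos : 0 < V.weight A) :
    V.IsPartitionedComponent (V.restrict A) := by
  -- Members of a partition must have positive weight, so a null complement has to be left out; in
  -- that case `V` alone is the partition.
  rcases eq_or_ne (V.weight Aᶜ) 0 with h0 | h0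
  · have hVA : V.restrict A = V := by
      rw [restrict_congr (B := univ) (by rwa [eventuallyEq_univ, mem_ae_iff]), restrict_univ]
    refine ⟨{V.restrict A}, ⟨?_, fun β => ?_, fun φ => ?_⟩, rfl⟩
    · rintro W rfl
      exact ⟨A, hA.nullMeasurableSet, hpos, h, rfl⟩
    · rw [hVA]
      exact hasSum_singleton V (fun W : Varifold m U => ∫ p, β p ∂W.μ)
    · rw [hVA]
      exact hasSum_singleton V (fun W : Varifold m U => ∫ x, φ x ∂W.varMeasure)
  -- A partition is a set, so the two pieces must be distinct varifolds for each to be counted in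
  -- the sums; the weight of `Aᶜ` tells them apart.
  · have hne : V.restrict A ≠ V.restrict Aᶜ := fun he => by
      have h1 := congrArg (fun W : Varifold m U => W.weight Aᶜ) he
      simp only [weight_restrict hA, weight_restrict hA.compl, Measure.restrict_apply hA.compl,
        compl_inter_self, inter_self, measure_empty] at h1
      exact h0 h1.symm
    refine ⟨{V.restrict A, V.restrict Aᶜ}, ⟨?_, fun β => ?_, fun φ => ?_⟩, Or.inl rfl⟩
    · rintro W (rfl | rfl)
      · exact ⟨A, hA.nullMeasurableSet, hpos, h, rfl⟩
      · exact ⟨Aᶜ, hA.compl.nullMeasurableSet, pos_iff_ne_zero.2 h0, h.compl hV hA, rfl⟩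
    · have h1 := integral_add_compl (f := fun p => β p) (hA.prod (MeasurableSet.univ (α := Grass n m)))
        (β.continuous.integrable_of_hasCompactSupport (μ := V.μ) β.hasCompactSupport)
      have hc : (A ×ˢ (univ : Set (Grass n m)))ᶜ = Aᶜ ×ˢ univ := by
        ext; simp
      rw [hc] at h1
      rw [← h1]
      exact hasSum_pair hne (fun W : Varifold m U => ∫ p, β p ∂W.μ)
    · have : IsFiniteMeasureOnCompacts V.varMeasure := hV
      have h1 := integral_add_compl (f := fun x => φ x) hA
        (φ.continuous.integrable_of_hasCompactSupport (μ := V.varMeasure) φ.hasCompactSupport)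
      rw [← h1, ← h.varMeasure_restrict hV hA, ← (h.compl hV hA).varMeasure_restrict hV hA.compl]
      exact hasSum_pair hne (fun W : Varifold m U => ∫ x, φ x ∂W.varMeasure)

/-! ### Localising weak differentiability -/

variable {Y : Type*} [NormedAddCommGroup Y] [NormedSpace ℝ Y] [FiniteDimensional ℝ Y]
  {D K : Set Y} {f : U → Y} {F : U → E n →L[ℝ] Y}

/-- The defining identity of weak differentiability, localised to `f⁻¹(K)`. -/
theorem HasWeakDeriv.identity_indicator (hf : V.HasWeakDeriv f F) (hD : IsClosed D)
    (hK : IsCompact K) (hDK : Disjoint K D) (hsing : V.varMeasure ≪ V.weight)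
    (hfDK : V.weight (f ⁻¹' (D ∪ K))ᶜ = 0) (hA : MeasurableSet A)
    (hAK : A =ᵐ[V.weight] f ⁻¹' K) (θ : 𝓓(U, E n)) {γ : Y → ℝ} (hγ : ContDiff ℝ ∞ γ) :
    ExtEq V.firstVariation (A.indicator fun x => γ (f x) • θ x)
      ((∫ p : U × Grass n m, γ (f p.1) * planeDiv p.2 θ p.1 ∂(V.restrict A).μ) +
        ∫ x : U, fderiv ℝ γ (f x) (F x (θ x)) ∂(V.restrict A).weight) := by
  obtain ⟨ζ, hζ, hζc, hζs, hζ1, -⟩ := exists_contDiff_one_nhdsSet hK hD.isOpen_compl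
    (disjoint_left.1 hDK)
  have hnhds : ∀ y ∈ K, (fun z => γ z * ζ z) =ᶠ[𝓝 y] γ := fun y hy => by
    filter_upwards [eventually_nhdsSet_iff_forall.1 hζ1 y hy] with z hz
    rw [hz, mul_one]
  -- Control of the closed support, not merely of the nonvanishing set, makes the derivative of `γζ`
  -- vanish on `D` as well.
  have hsub : tsupport (fun z => γ z * ζ z) ⊆ Dᶜ := (tsupport_mul_subset_right).trans hζs
  have hae : ∀ᵐ x ∂V.weight, (x ∈ A → f x ∈ K) ∧ (x ∉ A → f x ∈ D) := by
    have h1 : ∀ᵐ x ∂V.weight, f x ∈ D ∪ K := hfDK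
    filter_upwards [h1, hAK] with x hx hxA
    have hxA' : (x ∈ A) = (f x ∈ K) := hxA
    rw [hxA']
    exact ⟨id, fun h => hx.resolve_right h⟩
  -- The factor `ζ` makes `γζ` compactly supported, so no support condition on `γ` or its derivative
  -- is required.
  have h := hf.identity θ (fun z => γ z * ζ z) (hγ.mul hζ)
    ((HasCompactSupport.mul_left hζc).fderiv ℝ)
  have e0 : ∀ᵐ x ∂V.weight, γ (f x) * ζ (f x) = A.indicator (fun x => γ (f x)) x := by
    filter_upwards [hae] with x hx
    by_cases hxA : x ∈ A
    · rw [indicator_of_mem hxA]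
      exact (hnhds _ (hx.1 hxA)).self_of_nhds
    · rw [indicator_of_notMem hxA]
      exact image_eq_zero_of_notMem_tsupport (f := fun z => γ z * ζ z)
        fun hs => hsub hs (hx.2 hxA)
  have e1 : ∫ p : U × Grass n m, γ (f p.1) * ζ (f p.1) * planeDiv p.2 θ p.1 ∂V.μ =
      ∫ p : U × Grass n m, γ (f p.1) * planeDiv p.2 θ p.1 ∂(V.restrict A).μ := by
    rw [restrict, ← integral_indicator (hA.prod MeasurableSet.univ)]
    refine integral_congr_ae ?_
    filter_upwards [ae_of_ae_weight e0] with p hp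
    rw [hp]
    by_cases hpA : p.1 ∈ A
    · have hp' : p ∈ A ×ˢ (univ : Set (Grass n m)) := ⟨hpA, mem_univ _⟩
      rw [indicator_of_mem hpA, indicator_of_mem hp']
    · rw [indicator_of_notMem hpA, indicator_of_notMem fun h => hpA h.1, zero_mul]
  have e2 : ∫ x : U, fderiv ℝ (fun z => γ z * ζ z) (f x) (F x (θ x)) ∂V.weight =
      ∫ x : U, fderiv ℝ γ (f x) (F x (θ x)) ∂(V.restrict A).weight := by
    rw [weight_restrict hA, ← integral_indicator hA]
    refine integral_congr_ae ?_
    filter_upwards [hae] with x hx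
    by_cases hxA : x ∈ A
    · rw [indicator_of_mem hxA, (hnhds _ (hx.1 hxA)).fderiv_eq]
    · have h0 : fderiv ℝ (fun z => γ z * ζ z) (f x) = 0 := by
        by_contra h0
        exact hsub (support_fderiv_subset ℝ h0) (hx.2 hxA)
      rw [indicator_of_notMem hxA, h0]
      rfl
  rw [e1, e2] at h
  refine h.congr_ae ?_
  -- Absolute continuity enters here: the equality `(γζ) ∘ f = 1_A (γ ∘ f)` is known `‖V‖`-almost
  -- everywhere, whereas the argument of `δV` is determined only up to `‖δV‖`-null sets.
  filter_upwards [hsing.ae_le e0] with x hx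
  rw [hx]
  exact (indicator_smul_apply_left A (fun x => γ (f x)) (fun x : U => θ x) x).symm

/-- With `γ = 1` the derivative term drops out of the localised identity, and what remains is
`δV(1_A θ) = δ(V ⌞ A)(θ)`. -/
theorem HasWeakDeriv.zeroBoundary (hf : V.HasWeakDeriv f F) (hD : IsClosed D)
    (hK : IsCompact K) (hDK : Disjoint K D) (hsing : V.varMeasure ≪ V.weight)
    (hfDK : V.weight (f ⁻¹' (D ∪ K))ᶜ = 0) (hA : MeasurableSet A)
    (hAK : A =ᵐ[V.weight] f ⁻¹' K) : V.ZeroBoundary A := fun θ => by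
  have h := hf.identity_indicator hD hK hDK hsing hfDK hA hAK θ (γ := fun _ => 1)
    contDiff_const
  simpa [firstVariation] using h

/-- The derivative `F` is kept. The localised identity evaluates `δV` at `1_A (γ ∘ f) θ`, and zero
boundary lets `ExtEq.of_indicator` read this as `δ(V ⌞ A)` at `(γ ∘ f) θ`. -/
theorem HasWeakDeriv.restrict (hf : V.HasWeakDeriv f F) (hV : V.RadonVariation) (hD : IsClosed D)
    (hK : IsCompact K) (hDK : Disjoint K D) (hsing : V.varMeasure ≪ V.weight)
    (hfDK : V.weight (f ⁻¹' (D ∪ K))ᶜ = 0) (hA : MeasurableSet A)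
    (hAK : A =ᵐ[V.weight] f ⁻¹' K) : (V.restrict A).HasWeakDeriv f F := by
  have : IsFiniteMeasureOnCompacts (variation V.firstVariation) := hV
  have h0 := hf.zeroBoundary hD hK hDK hsing hfDK hA hAK
  refine ⟨?_, ?_, fun C s hC hs => ?_, fun θ γ hγ _ => ?_⟩
  · rw [weight_restrict hA, h0.varMeasure_restrict hV hA, ← Measure.restrict_add]
    exact hf.aestronglyMeasurable.restrict
  · rw [weight_restrict hA]
    exact hf.aestronglyMeasurable_deriv.restrict
  · rw [weight_restrict hA]
    exact (hf.integrableOn_deriv C s hC hs).mono_measure Measure.restrict_le_self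
  · exact (hf.identity_indicator hD hK hDK hsing hfDK hA hAK θ hγ).of_indicator hA h0

end Varifold

end VarifoldTheory

end

theorem mainTheorem7 {n m : ℕ} (hm : 0 < m) (hmn : m ≤ n)
    (U : TopologicalSpace.Opens (VarifoldTheory.E n))
    {Y : Type*} [NormedAddCommGroup Y] [NormedSpace ℝ Y] [FiniteDimensional ℝ Y]
    (D K : Set Y) (hD : IsClosed D) (hK : IsCompact K) (hDK : Disjoint K D)
    (V : VarifoldTheory.Varifold m U) (hV : V.RadonVariation)
    (hsing : V.varMeasure ≪ V.weight)
    (f : U → Y) (hf : V.WeaklyDiff f)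
    (hfDK : V.weight (f ⁻¹' (D ∪ K))ᶜ = 0) (hfK : 0 < V.weight (f ⁻¹' K)) :
    ∃ W : VarifoldTheory.Varifold m U,
      W = V.restrict (f ⁻¹' K) ∧
      V.IsPartitionedComponent W ∧
      V.ZeroBoundary (f ⁻¹' K) ∧
      W.weight (f ⁻¹' K)ᶜ = 0 ∧
      W.RadonVariation ∧
      W.WeaklyDiff f := by
  obtain ⟨F, hF⟩ := hf
  have hfm : AEStronglyMeasurable f V.weight := hF.aestronglyMeasurable.mono_measure
    (Measure.le_add_right le_rfl)
  have hnull : NullMeasurableSet (f ⁻¹' K) V.weight := by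
    borelize Y
    exact hfm.aemeasurable.nullMeasurableSet_preimage hK.isClosed.measurableSet
  -- As `f` is only almost everywhere measurable, `f⁻¹(K)` is replaced by a Borel set `A` that
  -- agrees with it up to a `‖V‖`-null set, hence also up to a `‖δV‖`-null set. All the conclusions
  -- are insensitive to this change.
  obtain ⟨A, hA, hAK⟩ := hnull
  have hAK' := hAK.symm
  have h0 := hF.zeroBoundary hD hK hDK hsing hfDK hA hAK'
  refine ⟨V.restrict (f ⁻¹' K), rfl, ?_, h0.congr hAK' (hsing.ae_eq hAK'), ?_, ?_, ?_⟩
  · rw [VarifoldTheory.Varifold.restrict_congr hAK]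
    exact h0.isPartitionedComponent hV hA (by rwa [measure_congr hAK'])
  · rw [VarifoldTheory.Varifold.restrict_congr hAK,
      VarifoldTheory.Varifold.weight_restrict hA, measure_congr (hAK.filter_mono
        (ae_mono Measure.restrict_le_self)).compl, Measure.restrict_apply hA.compl,
      compl_inter_self, measure_empty]
  · rw [VarifoldTheory.Varifold.restrict_congr hAK]
    have : IsFiniteMeasureOnCompacts V.varMeasure := hV
    refine ⟨fun C hC => ?_⟩
    rw [h0.varMeasure_restrict hV hA]
    exact hC.measure_lt_top
  · rw [VarifoldTheory.Varifold.restrict_congr hAK]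
    exact ⟨F, hF.restrict hV hD hK hDK hsing hfDK hA hAK'⟩
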